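/- Let $N\ge 2$ and $L>0$, and write $x=(x',x_N)\in\mathbb R^{N}$ with $x'=(x_1,\dots,x_{N-1})$. For $\eta>0$ and $k\in\{1,2,\dots,\infty\}$, let $\Omega\subset\mathbb R^N$ be a bounded domain (open, connected) such that $$\Omega\cap\{x_N<\eta\}=\{L|x'|<x_N<\eta\}$$ and such that $\partial\Omega\cap\{x_N>\eta/2\}$ is a hypersurface of class $C^k$, with $\Omega$ locally on one side of it. Then: 1. $\Omega$ is a bounded Lipschitz domain, $0\in\partial\Omega$, and $\partial\Omega$ is of class $C^k$ away from the single point $0$; in particular $\Omega$ is piecewise $C^1$. 2. Let $C_1,C_2>0$ be constants such that $$\int_{\partial\Omega}|u|\,d\mathcal H_{N-1}\le C_1\int_\Omega|Du|+C_2\int_\Omega|u|$$ holds for all $u\in W^{1,1}(\Omega)$, or such that it holds for all $u\in BV(\Omega)$; on the left-hand side $u$ stands for its trace on $\partial\Omega$, and for $u\in BV(\Omega)$ the quantity $\int_\Omega|Du|$ is the total variation of the distributional gradient $Du$. Then, in either case, $C_1\ge\sqrt{1+L^2}$. 3. Consequently the following assertion, which is true for every bounded $C^1$ domain, is false for $\Omega$: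 for every $\varepsilon>0$ there is $C_2>0$ such that $\int_{\partial\Omega}|u|\,d\mathcal H_{N-1}\le(1+\varepsilon)\int_\Omega|Du|+C_2\int_\Omega|u|$ for all $u\in W^{1,1}(\Omega)$. Moreover, for all $N\ge2$, $L>0$, $\eta>0$ such domains $\Omega$ exist, even with $k=\infty$; so this assertion does not extend from $C^1$ domains to piecewise $C^1$ Lipschitz domains. -/

import Mathlib

open MeasureTheory Set Filter Topology
open scoped ENNReal NNReal

namespace ConeTrace

/-- The space `ℝ^N` with its Euclidean norm. -/
abbrev E (N : ℕ) : Type := EuclideanSpace ℝ (Fin N)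

/-- `x' = (x_1, …, x_{N-1})` for `x ∈ ℝ^N`, where `N = n + 1`. -/
noncomputable def horiz {n : ℕ} (x : E (n + 1)) : E n :=
  WithLp.toLp 2 (fun i : Fin n => x i.castSucc)

/-- The last coordinate `x_N` of `x ∈ ℝ^N`, where `N = n + 1`. -/
def vert {n : ℕ} (x : E (n + 1)) : ℝ := x (Fin.last n)

/-- `φ ∈ C_c^∞(Ω; F)`, each test function being extended by zero to the whole space. -/
def IsTestFunction {N : ℕ} {F : Type*} [NormedAddCommGroup F] [NormedSpace ℝ F]
    (Ω : Set (E N)) (φ : E N → F) : Prop :=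
  ContDiff ℝ ((⊤ : ℕ∞) : WithTop ℕ∞) φ ∧ HasCompactSupport φ ∧ tsupport φ ⊆ Ω

/-- `u ∈ W^{1,1}(Ω)` with weak gradient `G`: both `u` and `G` are in `L^1(Ω)`, and
`∫_Ω u ∂_v φ = - ∫_Ω (G · v) φ` for all directions `v` and all `φ ∈ C_c^∞(Ω)`. -/
def IsSobolevWithGradient {N : ℕ} (Ω : Set (E N)) (u : E N → ℝ) (G : E N → E N) : Prop :=
  IntegrableOn u Ω ∧ IntegrableOn G Ω ∧
    ∀ φ : E N → ℝ, IsTestFunction Ω φ → ∀ v : E N,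
      ∫ x in Ω, u x * fderiv ℝ φ x v = - ∫ x in Ω, inner ℝ (G x) v * φ x

/-- The divergence of a vector field on `ℝ^N`. -/
noncomputable def divergence {N : ℕ} (φ : E N → E N) (x : E N) : ℝ :=
  ∑ i : Fin N, (fderiv ℝ φ x (EuclideanSpace.single i (1 : ℝ))) i

/-- The total variation `∫_Ω |Du| = ‖Du‖(Ω) ∈ [0, ∞]` of the distributional gradient of `u`,
`sup {∫_Ω u div φ : φ ∈ C_c^∞(Ω; ℝ^N), |φ| ≤ 1}`. -/
noncomputable def variation {N : ℕ} (Ω : Set (E N)) (u : E N → ℝ) : ℝ≥0∞ :=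
  ⨆ (φ : E N → E N) (_ : IsTestFunction Ω φ ∧ ∀ x, ‖φ x‖ ≤ 1),
    ENNReal.ofReal (∫ x in Ω, u x * divergence φ x)

/-- `u ∈ BV(Ω)`. -/
def IsBV {N : ℕ} (Ω : Set (E N)) (u : E N → ℝ) : Prop :=
  IntegrableOn u Ω ∧ variation Ω u < ⊤

/-- `g` is the trace of `u` on `∂Ω`: for almost every `x ∈ ∂Ω` with respect to the
`(N-1)`-dimensional Hausdorff measure, where `N = n + 1`, the averages of `|u - g(x)|` over
`B_r(x) ∩ Ω` tend to `0` as `r → 0+`. -/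
def IsTrace {n : ℕ} (Ω : Set (E (n + 1))) (u g : E (n + 1) → ℝ) : Prop :=
  ∀ᵐ x ∂((μHE[n] : Measure (E (n + 1))).restrict (frontier Ω)),
    Tendsto (fun r : ℝ => ⨍ y in Metric.ball x r ∩ Ω, |u y - g x|) (𝓝[>] 0) (𝓝 0)

/-- `∫_{∂Ω} |u| ≤ C₁ ∫_Ω |Du| + C₂ ∫_Ω |u|` for all `u ∈ W^{1,1}(Ω)`. -/
def SobolevTraceInequality {n : ℕ} (Ω : Set (E (n + 1))) (C₁ C₂ : ℝ) : Prop :=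
  ∀ (u : E (n + 1) → ℝ) (G : E (n + 1) → E (n + 1)) (g : E (n + 1) → ℝ),
    IsSobolevWithGradient Ω u G → IsTrace Ω u g →
      ∫⁻ x in frontier Ω, ‖g x‖ₑ ∂(μHE[n]) ≤
        ENNReal.ofReal C₁ * (∫⁻ x in Ω, ‖G x‖ₑ) + ENNReal.ofReal C₂ * (∫⁻ x in Ω, ‖u x‖ₑ)

/-- `∫_{∂Ω} |u| ≤ C₁ ∫_Ω |Du| + C₂ ∫_Ω |u|` for all `u ∈ BV(Ω)`. -/
def BVTraceInequality {n : ℕ} (Ω : Set (E (n + 1))) (C₁ C₂ : ℝ) : Prop :=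
  ∀ (u : E (n + 1) → ℝ) (g : E (n + 1) → ℝ),
    IsBV Ω u → IsTrace Ω u g →
      ∫⁻ x in frontier Ω, ‖g x‖ₑ ∂(μHE[n]) ≤
        ENNReal.ofReal C₁ * variation Ω u + ENNReal.ofReal C₂ * (∫⁻ x in Ω, ‖u x‖ₑ)

/-- Near its boundary point `p`, the set `Ω` is the side `ρ < 0` of a regular level set of a
function `ρ` of class `C^k`; so `∂Ω` is a `C^k` hypersurface near `p`, with `Ω` on one side. -/
def HasCkBoundaryAt {N : ℕ} (k : ℕ∞) (Ω : Set (E N)) (p : E N) : Prop :=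
  ∃ (U : Set (E N)) (ρ : E N → ℝ), IsOpen U ∧ p ∈ U ∧ ContDiffOn ℝ (k : WithTop ℕ∞) ρ U ∧
    fderiv ℝ ρ p ≠ 0 ∧ ∀ x ∈ U, x ∈ Ω ↔ ρ x < 0

/-- A bounded Lipschitz domain: bounded, open, connected, and near each boundary point, after a
rigid motion, the region above the graph of a Lipschitz function. -/
def IsBoundedLipschitzDomain {n : ℕ} (Ω : Set (E (n + 1))) : Prop :=
  IsOpen Ω ∧ IsConnected Ω ∧ Bornology.IsBounded Ω ∧
    ∀ p ∈ frontier Ω, ∃ (r : ℝ) (A : E (n + 1) ≃ₗᵢ[ℝ] E (n + 1)) (K : ℝ≥0) (f : E n → ℝ),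
      0 < r ∧ LipschitzWith K f ∧
        ∀ x ∈ Metric.ball p r, x ∈ Ω ↔ f (horiz (A x)) < vert (A x)

/-- A bounded domain `Ω` with `Ω ∩ {x_N < η} = {L|x'| < x_N < η}`, and such that
`∂Ω ∩ {x_N > η/2}` is a hypersurface of class `C^k`. -/
structure IsConicalDomain {n : ℕ} (k : ℕ∞) (L η : ℝ) (Ω : Set (E (n + 1))) : Prop where
  isOpen : IsOpen Ω
  isConnected : IsConnected Ω
  isBounded : Bornology.IsBounded Ω
  cone : Ω ∩ {x | vert x < η} = {x | L * ‖horiz x‖ < vert x ∧ vert x < η}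
  boundary : ∀ p ∈ frontier Ω, η / 2 < vert p → HasCkBoundaryAt k Ω p

end ConeTrace

namespace ConeTrace

/-! Test the inequality with `u = (δ - x_N)⁺` for `0 < δ < η`. Let `S` be the cone truncated at
height `δ`. In `Ω` the gradient has norm `1` on `S` and vanishes above it, and `0 ≤ u ≤ δ` on `S`,
so the right-hand side is at most `(C₁ + C₂ δ)|S|`. On the boundary `u(z, L|z|) = (δ - L|z|)⁺` is
exactly the length of the vertical section of `S` over `z`. As the area element of the cone is `√(1
+ L²) dz`, Fubini bounds the boundary integral below by `√(1 + L²)|S|` (`le_lintegral_frontier`).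
Dividing by `|S|` and letting `δ → 0` gives `√(1 + L²) ≤ C₁` (`sqrt_le_add`, `sqrt_le`). The `BV`
case follows because Sobolev functions are `BV`, with no larger variation.

Only a lower bound for the area is needed (`area_lower_bound`). It comes from projecting narrow
sectors of the cone orthogonally to a tangent hyperplane: this does not increase Hausdorff measure,
which on `ℝ^(N-1)` is Lebesgue measure, and the Jacobian tends to `√(1 + L²)` as the sectors shrink.

Lipschitz regularity is explicit near the vertex; elsewhere a `C^1` boundary satisfies a cone
condition, which yields a graph (`exists_lipschitzWith_graph`). Examples are solids of revolution
that close up smoothly at height `3η`. -/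

/-! ### Coordinates `(x', x_N)`. -/

/-- The continuous linear map `x ↦ x'`. -/
noncomputable def horizL (n : ℕ) : E (n + 1) →L[ℝ] E n :=
  LinearMap.toContinuousLinearMap
    { toFun := horiz
      map_add' := fun x y => by ext i; simp [horiz]
      map_smul' := fun c x => by ext i; simp [horiz] }

/-- The continuous linear map `x ↦ x_N`. -/
noncomputable def vertL (n : ℕ) : E (n + 1) →L[ℝ] ℝ := EuclideanSpace.proj (Fin.last n)

variable {n : ℕ}

@[simp] lemma vertL_apply (x : E (n + 1)) : vertL n x = vert x := rfl

@[simp] lemma horiz_add (x y : E (n + 1)) : horiz (x + y) = horiz x + horiz y :=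
  map_add (horizL n) x y

@[simp] lemma horiz_sub (x y : E (n + 1)) : horiz (x - y) = horiz x - horiz y :=
  map_sub (horizL n) x y

@[simp] lemma horiz_smul (c : ℝ) (x : E (n + 1)) : horiz (c • x) = c • horiz x :=
  map_smul (horizL n) c x

@[simp] lemma horiz_zero : horiz (0 : E (n + 1)) = 0 := map_zero (horizL n)

@[simp] lemma vert_add (x y : E (n + 1)) : vert (x + y) = vert x + vert y :=
  map_add (vertL n) x y

@[simp] lemma vert_sub (x y : E (n + 1)) : vert (x - y) = vert x - vert y :=
  map_sub (vertL n) x y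

@[simp] lemma vert_smul (c : ℝ) (x : E (n + 1)) : vert (c • x) = c * vert x :=
  map_smul (vertL n) c x

@[simp] lemma vert_zero : vert (0 : E (n + 1)) = 0 := map_zero (vertL n)

lemma contDiff_horiz {k : WithTop ℕ∞} : ContDiff ℝ k (horiz : E (n + 1) → E n) :=
  (horizL n).contDiff

lemma contDiff_vert {k : WithTop ℕ∞} : ContDiff ℝ k (vert : E (n + 1) → ℝ) :=
  (vertL n).contDiff

@[fun_prop] lemma continuous_horiz : Continuous (horiz : E (n + 1) → E n) :=
  (horizL n).continuous

@[fun_prop] lemma continuous_vert : Continuous (vert : E (n + 1) → ℝ) :=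
  (vertL n).continuous

lemma norm_sq_eq_horiz_vert (x : E (n + 1)) : ‖x‖ ^ 2 = ‖horiz x‖ ^ 2 + vert x ^ 2 := by
  simp [EuclideanSpace.norm_sq_eq, Fin.sum_univ_castSucc, horiz, vert]

lemma inner_eq_horiz_vert (x y : E (n + 1)) :
    inner ℝ x y = inner ℝ (horiz x) (horiz y) + vert x * vert y := by
  simp [PiLp.inner_apply, Fin.sum_univ_castSucc, horiz, vert, mul_comm]

lemma abs_vert_le (x : E (n + 1)) : |vert x| ≤ ‖x‖ := by
  refine abs_le_of_sq_le_sq ?_ (norm_nonneg _)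
  nlinarith [norm_sq_eq_horiz_vert x, sq_nonneg ‖horiz x‖]

/-- The point `(z, t)` of `ℝ^N`. -/
noncomputable def mkPoint (z : E n) (t : ℝ) : E (n + 1) :=
  WithLp.toLp 2 (Fin.snoc (α := fun _ => ℝ) z.ofLp t)

@[simp] lemma horiz_mkPoint (z : E n) (t : ℝ) : horiz (mkPoint z t) = z := by
  ext i; simp [horiz, mkPoint]

@[simp] lemma vert_mkPoint (z : E n) (t : ℝ) : vert (mkPoint z t) = t := by
  simp [vert, mkPoint]

lemma norm_mkPoint_zero_one : ‖mkPoint (0 : E n) 1‖ = 1 := by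
  refine (pow_eq_one_iff_of_nonneg (norm_nonneg _) two_ne_zero).1 ?_
  simp [norm_sq_eq_horiz_vert]

lemma ext_horiz_vert {x y : E (n + 1)} (h : horiz x = horiz y) (h' : vert x = vert y) :
    x = y := by
  ext i
  refine Fin.lastCases h' (fun j => ?_) i
  simpa [horiz] using congrArg (fun z : E n => z j) h

lemma continuous_mkPoint : Continuous fun p : E n × ℝ => mkPoint p.1 p.2 := by
  refine (PiLp.continuous_toLp 2 _).comp (continuous_pi fun i => ?_)
  refine Fin.lastCases ?_ (fun j => ?_) i
  · simpa using continuous_snd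
  · simp only [Fin.snoc_castSucc]
    fun_prop

lemma measurePreserving_horiz_vert :
    MeasurePreserving (fun x : E (n + 1) => (horiz x, vert x)) volume volume := by
  have h1 := EuclideanSpace.volume_preserving_symm_measurableEquiv_toLp (Fin (n + 1))
  have h2 := volume_preserving_piFinSuccAbove (fun _ : Fin (n + 1) => ℝ) (Fin.last n)
  have h3 := (EuclideanSpace.volume_preserving_symm_measurableEquiv_toLp (Fin n)).symm
  have h4 := (Measure.measurePreserving_swap (μ := (volume : Measure ℝ))
    (ν := (volume : Measure (Fin n → ℝ))))
  have h5 := h3.prod (MeasurePreserving.id (volume : Measure ℝ))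
  have h := h5.comp (h4.comp (h2.comp h1))
  have e : (fun x : E (n + 1) => (horiz x, vert x)) =
      Prod.map (MeasurableEquiv.toLp 2 (Fin n → ℝ)).symm.symm id ∘ Prod.swap ∘
        MeasurableEquiv.piFinSuccAbove (fun _ => ℝ) (Fin.last n) ∘
          (MeasurableEquiv.toLp 2 (Fin (n + 1) → ℝ)).symm := by
    funext x
    refine Prod.ext ?_ ?_
    · ext i
      simp [horiz, MeasurableEquiv.piFinSuccAbove, Fin.init]
    · simp [vert, MeasurableEquiv.piFinSuccAbove]
  rw [e]
  exact h

/-! ### Area of the boundary of the cone. -/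

/-- `μHE[d]` does not increase under `1`-Lipschitz maps. -/
lemma euclideanHausdorffMeasure_image_le {X Y : Type*} [EMetricSpace X] [MeasurableSpace X]
    [BorelSpace X] [EMetricSpace Y] [MeasurableSpace Y] [BorelSpace Y] {f : X → Y}
    (hf : LipschitzWith 1 f) (d : ℕ) (s : Set X) :
    (μHE[d] : Measure Y) (f '' s) ≤ (μHE[d] : Measure X) s := by
  have h := hf.hausdorffMeasure_image_le (d := (d : ℝ)) (by positivity) s
  simp only [ENNReal.coe_one, ENNReal.one_rpow, one_mul] at h
  simp only [Measure.euclideanHausdorffMeasure_def, Measure.smul_apply]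
  exact smul_le_smul_of_nonneg_left h (zero_le)

/-- The parametrization `z ↦ (z, L|z|)` of the boundary of the cone. -/
noncomputable def coneGraph (L : ℝ) (z : E n) : E (n + 1) := mkPoint z (L * ‖z‖)

@[simp] lemma horiz_coneGraph (L : ℝ) (z : E n) : horiz (coneGraph L z) = z := by
  simp [coneGraph]

@[simp] lemma vert_coneGraph (L : ℝ) (z : E n) : vert (coneGraph L z) = L * ‖z‖ := by
  simp [coneGraph]

lemma measurableEmbedding_coneGraph (L : ℝ) :
    MeasurableEmbedding (coneGraph L : E n → E (n + 1)) := by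
  refine Continuous.measurableEmbedding ?_ ?_
  · exact continuous_mkPoint.comp (f := fun z : E n => (z, L * ‖z‖)) (by fun_prop)
  · intro z w h
    simpa using congrArg horiz h

/-- The orthogonal projection of `ℝ^N` to the hyperplane tangent to the cone along the ray of
direction `e`, this hyperplane being rotated to `ℝ^(N-1)`. -/
noncomputable def tangentProj (L : ℝ) (e : E n) (x : E (n + 1)) : E n :=
  horiz x + ((inner ℝ e (horiz x) + L * vert x) / √(1 + L ^ 2) - inner ℝ e (horiz x)) • e

/-- Only the component `a` of `x'` along `e` changes, to `(a + L x_N)/√(1 + L²)`; by Cauchy–Schwarz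
its square is at most `a² + x_N²`. -/
lemma lipschitzWith_tangentProj (L : ℝ) {e : E n} (he : ‖e‖ = 1) :
    LipschitzWith 1 (tangentProj L e) := by
  refine LipschitzWith.of_dist_le_mul fun x y => ?_
  rw [NNReal.coe_one, one_mul, dist_eq_norm, dist_eq_norm]
  have hsub : tangentProj L e x - tangentProj L e y = tangentProj L e (x - y) := by
    simp only [tangentProj, horiz_sub, vert_sub, inner_sub_right]
    module
  rw [hsub]
  generalize x - y = w
  refine (abs_le_of_sq_le_sq' ?_ (norm_nonneg _)).2
  have hc : 0 < √(1 + L ^ 2) := by positivity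
  have hc2 : √(1 + L ^ 2) ^ 2 = 1 + L ^ 2 := Real.sq_sqrt (by positivity)
  rw [norm_sq_eq_horiz_vert w, tangentProj, norm_add_sq_real, norm_smul, he, inner_smul_right,
    real_inner_comm e, Real.norm_eq_abs, mul_one, sq_abs]
  set a : ℝ := inner ℝ e (horiz w)
  have key : ((a + L * vert w) / √(1 + L ^ 2)) ^ 2 ≤ a ^ 2 + vert w ^ 2 := by
    rw [div_pow, hc2, div_le_iff₀ (by positivity)]
    nlinarith [sq_nonneg (L * a - vert w)]
  nlinarith

lemma tangentProj_coneGraph (L : ℝ) (e z : E n) :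
    tangentProj L e (coneGraph L z) =
      z + ((inner ℝ e z + L ^ 2 * ‖z‖) / √(1 + L ^ 2) - inner ℝ e z) • e := by
  simp only [tangentProj, horiz_coneGraph, vert_coneGraph]
  ring_nf

/-- The derivative of `tangentProj L e ∘ coneGraph L` at `z`. -/
noncomputable def tangentDeriv (L : ℝ) (e z : E n) : E n →L[ℝ] E n :=
  ContinuousLinearMap.id ℝ (E n) +
    ((√(1 + L ^ 2))⁻¹ • (innerSL ℝ e + (L ^ 2 * ‖z‖⁻¹) • innerSL ℝ z) - innerSL ℝ e).smulRight e

lemma hasFDerivAt_norm {z : E n} (hz : z ≠ 0) :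
    HasFDerivAt (fun z : E n => ‖z‖) (‖z‖⁻¹ • innerSL ℝ z) z := by
  have h := (hasStrictFDerivAt_norm_sq z).hasFDerivAt.sqrt (by simpa using hz)
  simp only [Real.sqrt_sq (norm_nonneg _)] at h
  refine h.congr_fderiv ?_
  ext v
  have : ‖z‖ ≠ 0 := by simpa using hz
  simp
  field_simp

lemma hasFDerivAt_tangentProj_coneGraph (L : ℝ) (e : E n) {z : E n} (hz : z ≠ 0) :
    HasFDerivAt (fun z => tangentProj L e (coneGraph L z)) (tangentDeriv L e z) z := by
  simp only [tangentProj_coneGraph]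
  have h1 : HasFDerivAt (fun z : E n => (inner ℝ e z : ℝ)) (innerSL ℝ e) z :=
    (innerSL ℝ e).hasFDerivAt
  have h2 := (((h1.add ((hasFDerivAt_norm hz).const_mul (L ^ 2))).const_mul
    (√(1 + L ^ 2))⁻¹).sub h1).smul_const e
  have h3 := (hasFDerivAt_id z).add h2
  rw [smul_smul] at h3
  refine h3.congr_of_eventuallyEq (Eventually.of_forall fun w => ?_)
  simp only [div_eq_inv_mul]
  rfl

/-- The derivative is the identity plus a rank-one map `v ↦ f(v) e`, so its determinant is `1 +
f(e)`. -/
lemma det_tangentDeriv (L : ℝ) {e : E n} (he : ‖e‖ = 1) (z : E n) :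
    (tangentDeriv L e z).det = (1 + L ^ 2 * (‖z‖⁻¹ * inner ℝ z e)) / √(1 + L ^ 2) := by
  have h : ((tangentDeriv L e z : E n →L[ℝ] E n) : E n →ₗ[ℝ] E n) = LinearMap.transvection
      (((√(1 + L ^ 2))⁻¹ • (innerSL ℝ e + (L ^ 2 * ‖z‖⁻¹) • innerSL ℝ z) - innerSL ℝ e :
        E n →L[ℝ] ℝ) : E n →ₗ[ℝ] ℝ) e := by
    ext v; simp [tangentDeriv, LinearMap.transvection]
  rw [ContinuousLinearMap.det, h, LinearMap.transvection.det]
  simp [he]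
  ring

/-- Points with the same image differ by a multiple of `e`. On this half-space, moving in direction
`e` does not decrease `‖z‖` and strictly increases `⟨e, z⟩`, hence also `⟨e, z⟩ + L²‖z‖`, which the
image determines. -/
lemma injOn_tangentProj_coneGraph (L : ℝ) {e : E n} (he : ‖e‖ = 1) :
    InjOn (fun z => tangentProj L e (coneGraph L z)) {z | 0 ≤ inner ℝ e z} := by
  have hc : 0 < √(1 + L ^ 2) := by positivity
  have aux : ∀ z w : E n, 0 ≤ inner ℝ e w → (inner ℝ e w : ℝ) ≤ inner ℝ e z →
      tangentProj L e (coneGraph L z) = tangentProj L e (coneGraph L w) → z = w := by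
    intro z w hw hwz h
    rw [tangentProj_coneGraph, tangentProj_coneGraph] at h
    have hee : (inner ℝ e e : ℝ) = 1 := by simp [he]
    have h1 := congrArg (fun v => (inner ℝ e v : ℝ)) h
    simp only [inner_add_right, inner_smul_right, hee, mul_one, add_sub_cancel] at h1
    have h2 : z = w + ((inner ℝ e z : ℝ) - inner ℝ e w) • e := by
      rw [h1] at h
      have h' := sub_eq_zero.2 h
      rw [← sub_eq_zero, ← h']
      module
    set s : ℝ := (inner ℝ e z : ℝ) - inner ℝ e w with hs
    have h3 : ‖w‖ ≤ ‖z‖ := by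
      refine (abs_le_of_sq_le_sq' ?_ (norm_nonneg _)).2
      rw [h2, norm_add_sq_real, inner_smul_right, real_inner_comm]
      nlinarith [sq_nonneg ‖s • e‖]
    have h4 : (inner ℝ e z : ℝ) + L ^ 2 * ‖z‖ = inner ℝ e w + L ^ 2 * ‖w‖ := by
      field_simp at h1; exact h1
    have h5 : s = 0 := by
      have := mul_le_mul_of_nonneg_left h3 (sq_nonneg L)
      linarith
    rw [h2, h5]; simp
  intro z hz w hw h
  rcases le_total (inner ℝ e w : ℝ) (inner ℝ e z) with hle | hle
  · exact aux z w hw hle h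
  · exact (aux w z hz hle h.symm).symm

/-- On a sector around `e` the Jacobian of the tangential projection is at least the stated
constant; the change of variables formula and the contraction property of the projection conclude.
-/
lemma area_lower_bound_of_subset_cap {L q : ℝ} (hq : 0 ≤ q) {e : E n} (he : ‖e‖ = 1)
    {A : Set (E n)} (hA : MeasurableSet A)
    (hAq : ∀ z ∈ A, z ≠ 0 ∧ q * ‖z‖ ≤ inner ℝ e z) :
    ENNReal.ofReal ((1 + L ^ 2 * q) / √(1 + L ^ 2)) * volume A ≤
      (μHE[n] : Measure (E (n + 1))) (coneGraph L '' A) := by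
  calc ENNReal.ofReal ((1 + L ^ 2 * q) / √(1 + L ^ 2)) * volume A
      = ∫⁻ _ in A, ENNReal.ofReal ((1 + L ^ 2 * q) / √(1 + L ^ 2)) := by simp
    _ ≤ ∫⁻ z in A, ENNReal.ofReal |(tangentDeriv L e z).det| := by
        refine setLIntegral_mono' hA fun z hz => ?_
        rw [det_tangentDeriv L he]
        refine ENNReal.ofReal_le_ofReal ((div_le_div_of_nonneg_right ?_ (Real.sqrt_nonneg _)).trans
          (le_abs_self _))
        have hz0 : 0 < ‖z‖ := norm_pos_iff.2 (hAq z hz).1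
        have : q ≤ ‖z‖⁻¹ * inner ℝ z e := by
          rw [real_inner_comm, inv_mul_eq_div, le_div_iff₀ hz0]
          exact (hAq z hz).2
        have := mul_le_mul_of_nonneg_left this (sq_nonneg L)
        linarith
    _ = volume ((fun z => tangentProj L e (coneGraph L z)) '' A) := by
        refine lintegral_abs_det_fderiv_eq_addHaar_image _ hA (fun z hz =>
          (hasFDerivAt_tangentProj_coneGraph L e (hAq z hz).1).hasFDerivWithinAt)
          ((injOn_tangentProj_coneGraph L he).mono fun z hz => ?_)
        exact (mul_nonneg hq (norm_nonneg z)).trans (hAq z hz).2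
    _ = (μHE[n] : Measure (E n)) (tangentProj L e '' (coneGraph L '' A)) := by
        rw [EuclideanSpace.euclideanHausdorffMeasure_eq_volume, image_image]
    _ ≤ _ := euclideanHausdorffMeasure_image_le (lipschitzWith_tangentProj L he) n _

/-- For `q < 1` the sectors around countably many dense directions cover everything but the origin;
made disjoint, they allow summing the sector estimates. -/
lemma area_lower_bound_of_lt_one (hn : 1 ≤ n) {L q : ℝ} (hq : 0 ≤ q) (hq1 : q < 1)
    {A : Set (E n)} (hA : MeasurableSet A) :
    ENNReal.ofReal ((1 + L ^ 2 * q) / √(1 + L ^ 2)) * volume A ≤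
      (μHE[n] : Measure (E (n + 1))).comap (coneGraph L) A := by
  have : Nonempty (Fin n) := ⟨⟨0, hn⟩⟩
  have hne : Nonempty (Metric.sphere (0 : E n) 1) :=
    (NormedSpace.sphere_nonempty.2 zero_le_one).to_subtype
  set d := TopologicalSpace.denseSeq (Metric.sphere (0 : E n) 1)
  have hd : ∀ i, ‖(d i : E n)‖ = 1 := fun i => by simp
  set S : ℕ → Set (E n) := fun i => {z | z ≠ 0 ∧ q * ‖z‖ ≤ inner ℝ (d i : E n) z}
  have hS : ∀ i, MeasurableSet (S i) := fun i =>
    (measurableSet_singleton (0 : E n)).compl.inter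
      (isClosed_le (f := fun z : E n => q * ‖z‖) (g := fun z => inner ℝ (d i : E n) z)
        (by fun_prop) (by fun_prop)).measurableSet
  have hcov : ∀ z : E n, z ≠ 0 → ∃ i, z ∈ S i := by
    intro z hz
    have hz0 : 0 < ‖z‖ := norm_pos_iff.2 hz
    have hopen : IsOpen {e : Metric.sphere (0 : E n) 1 | q * ‖z‖ < inner ℝ (e : E n) z} :=
      isOpen_lt (by fun_prop) (by fun_prop)
    obtain ⟨i, hi⟩ := (TopologicalSpace.denseRange_denseSeq _).exists_mem_open hopen
      ⟨⟨‖z‖⁻¹ • z, by simp [norm_smul, hz0.ne']⟩, by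
        simp only [mem_ofPred_eq, inner_smul_left, real_inner_self_eq_norm_sq]
        simp only [conj_trivial]
        have : ‖z‖⁻¹ * ‖z‖ ^ 2 = ‖z‖ := by field_simp
        rw [this]; nlinarith⟩
    exact ⟨i, hz, le_of_lt hi⟩
  set D := disjointed S
  have hD : ∀ i, MeasurableSet (D i) := fun i => MeasurableSet.disjointed hS i
  have hvol : volume A = ∑' i, volume (A ∩ D i) := by
    rw [← measure_iUnion (fun i j hij => ((disjoint_disjointed S hij).mono
      inter_subset_right inter_subset_right)) (fun i => hA.inter (hD i)), ← inter_iUnion,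
      iUnion_disjointed]
    refine (measure_congr ?_)
    have h0 : ∀ᵐ z : E n, z ≠ 0 := by simp [ae_iff]
    filter_upwards [h0] with z hz
    refine propext ⟨fun h => ⟨h, mem_iUnion.2 (hcov z hz)⟩, fun h => h.1⟩
  rw [hvol, ← ENNReal.tsum_mul_left]
  calc _ ≤ ∑' i, (μHE[n] : Measure (E (n + 1))).comap (coneGraph L) (A ∩ D i) := by
        refine ENNReal.tsum_le_tsum fun i => ?_
        rw [(measurableEmbedding_coneGraph L).comap_apply]
        exact area_lower_bound_of_subset_cap hq (hd i) (hA.inter (hD i))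
          fun z hz => disjointed_subset S i hz.2
    _ ≤ _ := by
        rw [← measure_iUnion (fun i j hij => ((disjoint_disjointed S hij).mono
          inter_subset_right inter_subset_right)) (fun i => hA.inter (hD i)), ← inter_iUnion]
        exact measure_mono inter_subset_left

/-- The area of the boundary of the cone above a set `A` is at least `√(1 + L²) |A|`. -/
lemma area_lower_bound (hn : 1 ≤ n) (L : ℝ) :
    ENNReal.ofReal (√(1 + L ^ 2)) • (volume : Measure (E n)) ≤
      (μHE[n] : Measure (E (n + 1))).comap (coneGraph L) := by
  refine Measure.le_iff.2 fun A hA => ?_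
  rw [Measure.smul_apply, smul_eq_mul]
  have hc : 0 < √(1 + L ^ 2) := by positivity
  -- The sectors narrow to rays as `q → 1`, and the constant at `q = 1` is `√(1 + L²)`.
  have hlim : Tendsto (fun q : ℝ => ENNReal.ofReal ((1 + L ^ 2 * q) / √(1 + L ^ 2)) * volume A)
      (𝓝[<] 1) (𝓝 (ENNReal.ofReal (√(1 + L ^ 2)) * volume A)) := by
    refine ENNReal.Tendsto.mul_const ?_ (Or.inl (by simpa using hc))
    refine (ENNReal.continuous_ofReal.tendsto _).comp ?_
    have : Continuous fun q : ℝ => (1 + L ^ 2 * q) / √(1 + L ^ 2) := by fun_prop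
    have h1 := (this.tendsto 1).mono_left (nhdsWithin_le_nhds (s := Iio 1))
    have h2 : (1 + L ^ 2 * 1) / √(1 + L ^ 2) = √(1 + L ^ 2) := by
      rw [mul_one, Real.div_sqrt]
    rwa [h2] at h1
  refine le_of_tendsto hlim ?_
  filter_upwards [Ioo_mem_nhdsLT (zero_lt_one' ℝ)] with q hq
  exact area_lower_bound_of_lt_one hn hq.1.le hq.2 hA

/-! ### Cone conditions and Lipschitz graphs. -/

/-- A set which near `p` satisfies a cone condition is near `p` the region above the graph of a
Lipschitz function. -/
lemma exists_lipschitzWith_graph {Ω : Set (E (n + 1))} (hΩ : IsOpen Ω) {p : E (n + 1)} {r : ℝ}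
    (A : E (n + 1) ≃ₗᵢ[ℝ] E (n + 1)) (K : ℝ≥0) (hne : (Ω ∩ Metric.ball p r).Nonempty)
    (hcone : ∀ x ∈ Metric.ball p r, ∀ w ∈ Metric.ball p r, w ∈ Ω →
      K * ‖horiz (A (x - w))‖ < vert (A (x - w)) → x ∈ Ω) :
    ∃ f : E n → ℝ, LipschitzWith K f ∧
      ∀ x ∈ Metric.ball p r, x ∈ Ω ↔ f (horiz (A x)) < vert (A x) := by
  have : Nonempty ↥(Ω ∩ Metric.ball p r) := hne.to_subtype
  have hbdd : ∀ z : E n, BddBelow (range fun w : ↥(Ω ∩ Metric.ball p r) =>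
      vert (A w) + K * ‖z - horiz (A w)‖) := by
    intro z
    refine ⟨-(‖p‖ + r), ?_⟩
    rintro _ ⟨w, rfl⟩
    have h1 := neg_le_of_abs_le (abs_vert_le (A (w : E (n + 1))))
    have h2 : ‖(w : E (n + 1))‖ ≤ ‖p‖ + r := by
      have h3 := w.2.2
      rw [mem_ball_iff_norm] at h3
      calc ‖(w : E (n + 1))‖ = ‖p + (w - p)‖ := by rw [add_sub_cancel]
        _ ≤ ‖p‖ + ‖(w : E (n + 1)) - p‖ := norm_add_le _ _
        _ ≤ _ := by linarith
    have h4 : 0 ≤ K * ‖z - horiz (A w)‖ := by positivity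
    rw [A.norm_map] at h1
    simp only
    linarith
  -- The lower envelope of the upward cones of slope `K` with vertices at the points of `Ω` in the
  -- ball.
  refine ⟨fun z => ⨅ w : ↥(Ω ∩ Metric.ball p r), (vert (A w) + K * ‖z - horiz (A w)‖), ?_, ?_⟩
  · refine LipschitzWith.of_le_add_mul K fun y z => ?_
    rw [← sub_le_iff_le_add]
    refine le_ciInf fun w => ?_
    rw [sub_le_iff_le_add]
    refine (ciInf_le (hbdd y) w).trans ?_
    have : ‖y - horiz (A w)‖ ≤ ‖z - horiz (A w)‖ + dist y z := by
      rw [dist_eq_norm]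
      have := norm_sub_le_norm_sub_add_norm_sub y z (horiz (A w))
      linarith
    have := mul_le_mul_of_nonneg_left this K.coe_nonneg
    linarith
  · intro x hx
    constructor
    · intro hxΩ
      -- Openness puts a point of `Ω` strictly below `x`, which makes the inequality strict.
      have hcont : Tendsto (fun s : ℝ => x - s • A.symm (mkPoint 0 1)) (𝓝[>] 0) (𝓝 x) := by
        have : Continuous fun s : ℝ => x - s • A.symm (mkPoint (0 : E n) 1) := by fun_prop
        simpa using (this.tendsto 0).mono_left (nhdsWithin_le_nhds (s := Ioi 0))
      obtain ⟨s, hs, hs0⟩ := ((hcont.eventually ((hΩ.inter Metric.isOpen_ball).mem_nhds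
        ⟨hxΩ, hx⟩)).and self_mem_nhdsWithin).exists
      refine (ciInf_le (hbdd _) ⟨_, hs⟩).trans_lt ?_
      have hs0 : 0 < s := hs0
      simp [map_sub, hs0]
    · intro hlt
      obtain ⟨w, hw⟩ := exists_lt_of_ciInf_lt hlt
      refine hcone x hx w w.2.2 w.2.1 ?_
      rw [map_sub, horiz_sub, vert_sub]
      linarith

lemma exists_linearIsometryEquiv_map_eq {F : Type*} [NormedAddCommGroup F] [InnerProductSpace ℝ F]
    [CompleteSpace F] {v w : F} (h : ‖v‖ = ‖w‖) : ∃ A : F ≃ₗᵢ[ℝ] F, A v = w :=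
  ⟨_, Submodule.reflection_sub h⟩

/-- Near a point of a `C^1` hypersurface the cone condition holds. -/
lemma HasCkBoundaryAt.exists_cone_condition {k : ℕ∞} (hk : 1 ≤ k) {Ω : Set (E (n + 1))}
    {p : E (n + 1)} (h : HasCkBoundaryAt k Ω p) :
    ∃ r : ℝ, 0 < r ∧ ∃ A : E (n + 1) ≃ₗᵢ[ℝ] E (n + 1),
      ∀ x ∈ Metric.ball p r, ∀ w ∈ Metric.ball p r, w ∈ Ω →
        ‖horiz (A (x - w))‖ < vert (A (x - w)) → x ∈ Ω := by
  obtain ⟨U, ρ, hU, hpU, hρ, hne, hmem⟩ := h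
  have hk0 : (k : WithTop ℕ∞) ≠ 0 := by
    have : k ≠ 0 := by rintro rfl; simp at hk
    exact_mod_cast this
  have hstrict := (hρ.contDiffAt (hU.mem_nhds hpU)).hasStrictFDerivAt hk0
  set D := fderiv ℝ ρ p
  set a := (InnerProductSpace.toDual ℝ (E (n + 1))).symm D with ha
  have haD : ∀ v, D v = inner ℝ a v := fun v => by
    rw [ha, InnerProductSpace.toDual_symm_apply]
  have ha0 : a ≠ 0 := by
    intro h0
    exact hne ((LinearIsometryEquiv.map_eq_zero_iff _).1 (ha ▸ h0))
  have hapos : 0 < ‖a‖ := norm_pos_iff.2 ha0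
  -- `A` turns the gradient `a` to point straight down, so that `ρ` decreases upwards.
  have hnorm : ‖a‖ = ‖(-‖a‖) • mkPoint (0 : E n) 1‖ := by
    rw [norm_smul, norm_mkPoint_zero_one]; simp
  obtain ⟨A, hA⟩ := exists_linearIsometryEquiv_map_eq hnorm
  have hDA : ∀ v, D v = -‖a‖ * vert (A v) := fun v => by
    rw [haD, ← A.inner_map_map, hA, inner_smul_left, inner_eq_horiz_vert]
    simp
  -- In the cone `‖x - w‖` is at most twice the height, so an error of `‖a‖/4` per unit length costs
  -- at most half of the linear decrease.
  have hev := (hstrict.isLittleO.def (show (0 : ℝ) < ‖a‖ / 4 by positivity)).and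
    (prod_mem_nhds (hU.mem_nhds hpU) (hU.mem_nhds hpU))
  obtain ⟨r, hr, hball⟩ := Metric.nhds_basis_ball.eventually_iff.1 hev
  refine ⟨r, hr, A, fun x hx w hw hwΩ hxw => ?_⟩
  have hxw' : (x, w) ∈ Metric.ball (p, p) r := by
    rw [← ball_prod_same]; exact ⟨hx, hw⟩
  obtain ⟨hest, hxU, hwU⟩ := hball hxw'
  rw [hmem x hxU]
  have hwρ := (hmem w hwU).1 hwΩ
  simp only [hDA] at hest
  have ht : ‖x - w‖ ≤ 2 * vert (A (x - w)) := by
    have h0 := norm_nonneg (horiz (A (x - w)))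
    refine (abs_le_of_sq_le_sq' ?_ (by linarith)).2
    rw [← A.norm_map, norm_sq_eq_horiz_vert]
    nlinarith
  have h1 := (le_abs_self _).trans hest
  have h2 := mul_le_mul_of_nonneg_left ht (show 0 ≤ ‖a‖ / 4 by positivity)
  have h3 : 0 < ‖a‖ * vert (A (x - w)) :=
    mul_pos hapos ((norm_nonneg _).trans_lt hxw)
  linarith

/-! ### Boundary regularity of conical domains. -/

namespace IsConicalDomain
variable {k : ℕ∞} {L η : ℝ} {Ω : Set (E (n + 1))}

lemma mem_iff (h : IsConicalDomain k L η Ω) {x : E (n + 1)} (hx : vert x < η) :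
    x ∈ Ω ↔ L * ‖horiz x‖ < vert x := by
  have := Set.ext_iff.1 h.cone x
  simp only [mem_inter_iff, mem_ofPred_eq, hx, and_true] at this
  exact this

lemma vert_eq (h : IsConicalDomain k L η Ω) {p : E (n + 1)} (hp : p ∈ frontier Ω)
    (hpη : vert p < η) : vert p = L * ‖horiz p‖ := by
  rw [h.isOpen.frontier_eq] at hp
  refine le_antisymm (not_lt.1 fun h' => hp.2 ((h.mem_iff hpη).2 h')) ?_
  by_contra! hlt
  have hU : IsOpen {x : E (n + 1) | vert x < L * ‖horiz x‖ ∧ vert x < η} :=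
    (isOpen_lt continuous_vert (continuous_const.mul continuous_horiz.norm)).inter
      (isOpen_lt continuous_vert continuous_const)
  obtain ⟨x, ⟨hx1, hx2⟩, hxΩ⟩ := mem_closure_iff.1 hp.1 _ hU ⟨hlt, hpη⟩
  exact absurd ((h.mem_iff hx2).1 hxΩ) (not_lt.2 hx1.le)

lemma coneGraph_mem_frontier (h : IsConicalDomain k L η Ω) {z : E n} (hz : L * ‖z‖ < η) :
    coneGraph L z ∈ frontier Ω := by
  rw [h.isOpen.frontier_eq]
  refine ⟨?_, fun h' => ?_⟩
  · have hc : Continuous fun t : ℝ => mkPoint z t :=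
      continuous_mkPoint.comp (f := fun t : ℝ => (z, t)) (by fun_prop)
    refine mem_closure_of_tendsto ((hc.tendsto (L * ‖z‖)).mono_left
      (nhdsWithin_le_nhds (s := Ioi (L * ‖z‖)))) ?_
    filter_upwards [Ioo_mem_nhdsGT hz] with t ht
    exact (h.mem_iff (by simpa using ht.2)).2 (by simpa using ht.1)
  · rw [h.mem_iff (by simpa using hz)] at h'
    simp at h'

lemma zero_mem_frontier (h : IsConicalDomain k L η Ω) (hη : 0 < η) : (0 : E (n + 1)) ∈ frontier Ω := by
  have h0 := h.coneGraph_mem_frontier (z := 0) (by simpa using hη)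
  rwa [show coneGraph L (0 : E n) = 0 from ext_horiz_vert (by simp) (by simp)] at h0

/-- Below height `η` the function `L|x'| - x_N` defines `Ω`. It is smooth off the axis, which meets
this part of the boundary only at the origin, and its vertical derivative is `-1`. -/
lemma hasCkBoundaryAt (h : IsConicalDomain k L η Ω) (hη : 0 < η) {p : E (n + 1)}
    (hp : p ∈ frontier Ω) (hp0 : p ≠ 0) : HasCkBoundaryAt k Ω p := by
  rcases lt_or_ge (vert p) η with hpη | hpη
  swap
  · exact h.boundary p hp (by linarith)
  have hv := h.vert_eq hp hpη
  have hh : horiz p ≠ 0 := fun h0 => hp0 (ext_horiz_vert (by simpa using h0) (by simp [hv, h0]))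
  have hdiff : ∀ x : E (n + 1), horiz x ≠ 0 →
      ContDiffAt ℝ (k : WithTop ℕ∞) (fun x => L * ‖horiz x‖ - vert x) x := fun x hx =>
    (contDiffAt_const.mul (contDiff_horiz.contDiffAt.norm ℝ hx)).sub contDiff_vert.contDiffAt
  refine ⟨{x | horiz x ≠ 0 ∧ vert x < η}, fun x => L * ‖horiz x‖ - vert x, ?_, ⟨hh, hpη⟩,
    fun x hx => (hdiff x hx.1).contDiffWithinAt, fun h0 => ?_, fun x hx => ?_⟩
  · exact (isOpen_ne_fun continuous_horiz continuous_const).inter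
      (isOpen_lt continuous_vert continuous_const)
  · have hd : DifferentiableAt ℝ (fun x : E (n + 1) => L * ‖horiz x‖ - vert x) p := by
      have h1 : DifferentiableAt ℝ (horiz : E (n + 1) → E n) p :=
        (contDiff_horiz (k := 1)).differentiable (by simp) p
      have h2 : DifferentiableAt ℝ (vert : E (n + 1) → ℝ) p :=
        (contDiff_vert (k := 1)).differentiable (by simp) p
      exact ((h1.norm ℝ hh).const_mul L).sub h2
    have hl := hd.hasFDerivAt.hasLineDerivAt (mkPoint 0 1)
    rw [h0] at hl
    have hl2 : HasLineDerivAt ℝ (fun x : E (n + 1) => L * ‖horiz x‖ - vert x) (-1) p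
        (mkPoint 0 1) := by
      have : HasDerivAt (fun t : ℝ => L * ‖horiz p‖ - (vert p + t)) (-1) 0 :=
        ((hasDerivAt_id (0 : ℝ)).const_add _).const_sub _
      simpa [HasLineDerivAt] using this
    have := hl.unique hl2
    simp at this
  · rw [h.mem_iff hx.2, sub_lt_zero]

lemma isBoundedLipschitzDomain (h : IsConicalDomain k L η Ω) (hk : 1 ≤ k) (hL : 0 < L)
    (hη : 0 < η) : IsBoundedLipschitzDomain Ω := by
  refine ⟨h.isOpen, h.isConnected, h.isBounded, fun p hp => ?_⟩
  rcases lt_or_ge (vert p) η with hpη | hpη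
  -- This radius keeps the ball below height `η`, where `Ω` is the region above the cone.
  · refine ⟨η - vert p, LinearIsometryEquiv.refl ℝ _, ⟨L, hL.le⟩, fun z => L * ‖z‖,
      by linarith, ?_, fun x hx => ?_⟩
    · refine LipschitzWith.of_dist_le_mul fun x y => ?_
      rw [Real.dist_eq, ← mul_sub, abs_mul, abs_of_pos hL, dist_eq_norm]
      exact mul_le_mul_of_nonneg_left (abs_norm_sub_norm_le x y) hL.le
    · rw [mem_ball_iff_norm] at hx
      have := (le_abs_self _).trans (abs_vert_le (x - p))
      rw [vert_sub] at this
      exact h.mem_iff (by linarith)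
  · obtain ⟨r, hr, A, hA⟩ := (h.boundary p hp (by linarith)).exists_cone_condition hk
    obtain ⟨f, hf, hfΩ⟩ := exists_lipschitzWith_graph h.isOpen (p := p) (r := r) A 1
      (by
        obtain ⟨x, hx⟩ := mem_closure_iff.1 (frontier_subset_closure hp) _ Metric.isOpen_ball
          (Metric.mem_ball_self hr)
        exact ⟨x, hx.2, hx.1⟩)
      (by simpa using hA)
    exact ⟨r, A, 1, f, hr, hf, hfΩ⟩

end IsConicalDomain

/-! ### Sobolev functions have bounded variation. -/

section Variation
variable {N : ℕ} {Ω : Set (E N)} {u : E N → ℝ} {G : E N → E N}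

lemma IsTestFunction.coord {φ : E N → E N} (hφ : IsTestFunction Ω φ) (i : Fin N) :
    IsTestFunction Ω fun x => φ x i := by
  have hsub : tsupport (fun x => φ x i) ⊆ tsupport φ :=
    tsupport_comp_subset (g := fun v : E N => v i) rfl φ
  refine ⟨(EuclideanSpace.proj i : E N →L[ℝ] ℝ).contDiff.comp hφ.1, ?_,
    hsub.trans hφ.2.2⟩
  exact hφ.2.1.comp_left (g := fun v : E N => v i) rfl

lemma IsTestFunction.divergence_eq {φ : E N → E N} (hφ : IsTestFunction Ω φ) (x : E N) :
    divergence φ x =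
      ∑ i : Fin N, fderiv ℝ (fun y => φ y i) x (EuclideanSpace.single i (1 : ℝ)) := by
  refine Finset.sum_congr rfl fun i _ => ?_
  have hd : DifferentiableAt ℝ φ x := hφ.1.differentiable (by simp) x
  have h := ((EuclideanSpace.proj i : E N →L[ℝ] ℝ).hasFDerivAt.comp x
    hd.hasFDerivAt).fderiv
  have h' : fderiv ℝ (fun y => φ y i) x =
      (EuclideanSpace.proj i : E N →L[ℝ] ℝ).comp (fderiv ℝ φ x) := h
  rw [h']
  rfl

lemma IsTestFunction.exists_bound {F : Type*} [NormedAddCommGroup F] [NormedSpace ℝ F]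
    {φ : E N → F} (hφ : IsTestFunction Ω φ) : ∃ C, ∀ x, ‖φ x‖ ≤ C :=
  hφ.1.continuous.bounded_above_of_compact_support hφ.2.1

lemma IsTestFunction.exists_bound_fderiv {φ : E N → ℝ} (hφ : IsTestFunction Ω φ) (v : E N) :
    Continuous (fun x => fderiv ℝ φ x v) ∧ ∃ C, ∀ x, ‖fderiv ℝ φ x v‖ ≤ C := by
  have hc : Continuous (fun x => fderiv ℝ φ x v) :=
    (hφ.1.continuous_fderiv (by simp)).clm_apply continuous_const
  exact ⟨hc, hc.bounded_above_of_compact_support (hφ.2.1.fderiv_apply ℝ v)⟩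

/-- The total variation of a Sobolev function is at most the `L^1` norm of its gradient. -/
lemma IsSobolevWithGradient.variation_le (h : IsSobolevWithGradient Ω u G) :
    variation Ω u ≤ ∫⁻ x in Ω, ‖G x‖ₑ := by
  obtain ⟨hu, hG, hw⟩ := h
  refine iSup₂_le fun φ hφ => ?_
  obtain ⟨hφ, hφ1⟩ := hφ
  have hcoord : ∀ (i : Fin N) (w : E N), inner ℝ w (EuclideanSpace.single i (1 : ℝ)) = w i := by
    intro i w
    simp [EuclideanSpace.inner_single_right]
  have hi1 : ∀ i : Fin N, Integrable (fun x => u x *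
      fderiv ℝ (fun y => φ y i) x (EuclideanSpace.single i (1 : ℝ))) (volume.restrict Ω) := by
    intro i
    obtain ⟨hc, C, hC⟩ := (hφ.coord i).exists_bound_fderiv (EuclideanSpace.single i (1 : ℝ))
    exact hu.mul_bdd hc.aestronglyMeasurable (Eventually.of_forall hC)
  have hi2 : ∀ i : Fin N, Integrable (fun x => G x i * φ x i) (volume.restrict Ω) := by
    intro i
    obtain ⟨C, hC⟩ := (hφ.coord i).exists_bound
    refine Integrable.mul_bdd ?_ (hφ.coord i).1.continuous.aestronglyMeasurable
      (Eventually.of_forall hC)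
    exact (EuclideanSpace.proj i : E N →L[ℝ] ℝ).integrable_comp hG
  have hint : ∫ x in Ω, u x * divergence φ x = ∫ x in Ω, -∑ i : Fin N, G x i * φ x i := by
    simp only [hφ.divergence_eq, Finset.mul_sum]
    rw [integral_finsetSum _ fun i _ => hi1 i, integral_neg,
      integral_finsetSum _ fun i _ => hi2 i, ← Finset.sum_neg_distrib]
    refine Finset.sum_congr rfl fun i _ => ?_
    rw [hw _ (hφ.coord i)]
    simp only [hcoord]
  rw [hint, ← ofReal_integral_norm_eq_lintegral_enorm hG]
  refine ENNReal.ofReal_le_ofReal (integral_mono (integrable_finsetSum _ fun i _ => hi2 i).neg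
    hG.norm fun x => ?_)
  have h1 : (∑ i : Fin N, G x i * φ x i) = inner ℝ (G x) (φ x) := by
    simp [PiLp.inner_apply, mul_comm]
  simp only [h1]
  calc -inner ℝ (G x) (φ x) ≤ |inner ℝ (G x) (φ x)| := neg_le_abs _
    _ ≤ ‖G x‖ * ‖φ x‖ := abs_real_inner_le_norm _ _
    _ ≤ ‖G x‖ := mul_le_of_le_one_right (norm_nonneg _) (hφ1 x)

end Variation

lemma BVTraceInequality.sobolevTraceInequality {Ω : Set (E (n + 1))} {C₁ C₂ : ℝ}
    (h : BVTraceInequality Ω C₁ C₂) : SobolevTraceInequality Ω C₁ C₂ := by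
  intro u G g hu hg
  have hvar := hu.variation_le
  refine (h u g ⟨hu.1, hvar.trans_lt hu.2.1.2⟩ hg).trans ?_
  gcongr

/-! ### The test function. -/

/-- The function `u(x) = (δ - x_N)⁺`. -/
noncomputable def ramp (δ : ℝ) (x : E (n + 1)) : ℝ := max (δ - vert x) 0

/-- The gradient of `ramp δ`. -/
noncomputable def rampGrad (δ : ℝ) : E (n + 1) → E (n + 1) :=
  {x | vert x < δ}.indicator fun _ => -mkPoint 0 1

lemma lipschitzWith_ramp (δ : ℝ) : LipschitzWith 1 (ramp δ : E (n + 1) → ℝ) := by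
  refine LipschitzWith.of_dist_le_mul fun x y => ?_
  rw [NNReal.coe_one, one_mul, Real.dist_eq, dist_eq_norm]
  refine (abs_max_sub_max_le_abs _ _ _).trans ?_
  have := abs_vert_le (x - y)
  rw [vert_sub, abs_sub_comm] at this
  simpa using this

lemma measurableSet_vert_lt (δ : ℝ) : MeasurableSet {x : E (n + 1) | vert x < δ} :=
  (isOpen_lt continuous_vert continuous_const).measurableSet

lemma volume_vert_eq (δ : ℝ) : volume {x : E (n + 1) | vert x = δ} = 0 := by
  have h := (measurePreserving_horiz_vert (n := n)).measure_preimage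
    ((MeasurableSet.univ.prod (measurableSet_singleton δ)).nullMeasurableSet)
  have h1 : (fun x : E (n + 1) => (horiz x, vert x)) ⁻¹' (univ ×ˢ {δ}) = {x | vert x = δ} := by
    ext x; simp
  rw [h1] at h
  rw [h, Measure.volume_eq_prod, Measure.prod_prod]
  simp

lemma enorm_rampGrad (δ : ℝ) (x : E (n + 1)) :
    ‖rampGrad δ x‖ₑ = {x : E (n + 1) | vert x < δ}.indicator 1 x := by
  rw [rampGrad, enorm_indicator_eq_indicator_enorm]
  congr 1
  funext y
  rw [enorm_neg, ← ofReal_norm, norm_mkPoint_zero_one]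
  simp

lemma lineDeriv_ramp {δ : ℝ} {x : E (n + 1)} (hx : vert x ≠ δ) (v : E (n + 1)) :
    lineDeriv ℝ (ramp δ) x v = inner ℝ (rampGrad δ x) v := by
  refine HasLineDerivAt.lineDeriv ?_
  rcases lt_or_gt_of_ne hx with h | h
  · have h1 : HasFDerivAt (fun y : E (n + 1) => δ - vert y) (-vertL n) x :=
      (vertL n).hasFDerivAt.const_sub δ
    have h2 := h1.hasLineDerivAt v
    have h3 : inner ℝ (rampGrad δ x) v = (-vertL n) v := by
      rw [rampGrad, indicator_of_mem (by exact h), inner_neg_left, inner_eq_horiz_vert]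
      simp
    rw [h3]
    refine h2.congr_of_eventuallyEq ?_
    filter_upwards [(isOpen_lt continuous_vert continuous_const).mem_nhds h] with y hy
    exact max_eq_left (by have : vert y < δ := hy; linarith)
  · have h3 : inner ℝ (rampGrad δ x) v = 0 := by
      rw [rampGrad, indicator_of_notMem (by simpa using h.le), inner_zero_left]
    rw [h3]
    refine ((hasFDerivAt_const (0 : ℝ) x).hasLineDerivAt v).congr_of_eventuallyEq ?_
    filter_upwards [(isOpen_lt continuous_const continuous_vert).mem_nhds h] with y hy
    exact max_eq_right (by have : δ < vert y := hy; linarith)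

/-- Integration by parts for Lipschitz functions on the whole space suffices, since the test
function vanishes outside `Ω`; the gradient is classical off a null hyperplane. -/
lemma isSobolevWithGradient_ramp {Ω : Set (E (n + 1))} (hΩ : Bornology.IsBounded Ω)
    (δ : ℝ) : IsSobolevWithGradient Ω (ramp δ) (rampGrad δ) := by
  have hvol : volume Ω ≠ ⊤ := hΩ.measure_lt_top.ne
  refine ⟨?_, ?_, fun φ hφ v => ?_⟩
  · exact ((lipschitzWith_ramp δ).continuous.continuousOn.integrableOn_compact
      hΩ.isCompact_closure).mono_set subset_closure
  · exact (integrableOn_const hvol).indicator (measurableSet_vert_lt δ)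
  · have hφ0 : ∀ x, x ∉ Ω → φ x = 0 := fun x hx =>
      image_eq_zero_of_notMem_tsupport fun h => hx (hφ.2.2 h)
    have hφ1 : ∀ x, x ∉ Ω → fderiv ℝ φ x = 0 := fun x hx =>
      image_eq_zero_of_notMem_tsupport fun h => hx (hφ.2.2 (tsupport_fderiv_subset ℝ h))
    rw [setIntegral_eq_integral_of_forall_compl_eq_zero fun x hx => by simp [hφ1 x hx],
      setIntegral_eq_integral_of_forall_compl_eq_zero fun x hx => by simp [hφ0 x hx]]
    obtain ⟨C, hC⟩ := hφ.1.lipschitzWith_of_hasCompactSupport hφ.2.1 (by simp)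
    have hparts := (lipschitzWith_ramp δ).integral_lineDeriv_mul_eq (μ := volume) hC hφ.2.1 v
    have h1 : ∫ x, lineDeriv ℝ (ramp δ) x v * φ x = ∫ x, inner ℝ (rampGrad δ x) v * φ x := by
      refine integral_congr_ae ?_
      have : ∀ᵐ x : E (n + 1), vert x ≠ δ := by
        rw [ae_iff]; simpa using volume_vert_eq δ
      filter_upwards [this] with x hx
      rw [lineDeriv_ramp hx]
    have h2 : ∫ x, lineDeriv ℝ φ x (-v) * ramp δ x = -∫ x, ramp δ x * fderiv ℝ φ x v := by
      rw [← integral_neg]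
      refine integral_congr_ae (Eventually.of_forall fun x => ?_)
      have hd : DifferentiableAt ℝ φ x := hφ.1.differentiable (by simp) x
      simp only [hd.lineDeriv_eq_fderiv, map_neg]
      ring
    rw [h1, h2] at hparts
    rw [hparts, neg_neg]

/-- The average over a ball of radius `r` is at most `C r`. -/
lemma isTrace_self {Ω : Set (E (n + 1))} {u : E (n + 1) → ℝ} {C : ℝ≥0}
    (hu : LipschitzWith C u) : IsTrace Ω u u := by
  refine Eventually.of_forall fun x => ?_
  have hlim : Tendsto (fun r : ℝ => C * r) (𝓝[>] 0) (𝓝 0) := by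
    have : Continuous fun r : ℝ => C * r := by fun_prop
    simpa using (this.tendsto 0).mono_left (nhdsWithin_le_nhds (s := Ioi 0))
  refine tendsto_of_tendsto_of_tendsto_of_le_of_le' tendsto_const_nhds hlim
    (Eventually.of_forall fun r => integral_nonneg fun y => abs_nonneg _) ?_
  filter_upwards [self_mem_nhdsWithin] with r hr
  have hr : 0 < r := hr
  rw [setAverage_eq, smul_eq_mul]
  have hfin : volume (Metric.ball x r ∩ Ω) < ⊤ :=
    (measure_mono inter_subset_left).trans_lt measure_ball_lt_top
  have hb := norm_setIntegral_le_of_norm_le_const (f := fun y => |u y - u x|) (C := C * r) hfin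
    (fun y hy => by
      rw [Real.norm_eq_abs, abs_abs, ← Real.dist_eq]
      exact (hu.dist_le_mul y x).trans
        (mul_le_mul_of_nonneg_left (Metric.mem_ball.1 hy.1).le C.coe_nonneg))
  have hb' := (le_abs_self _).trans hb
  rw [mul_comm (C * r : ℝ)] at hb'
  -- If the intersection is null, the average is `0` by convention.
  rcases eq_or_lt_of_le (measureReal_nonneg (μ := volume) (s := Metric.ball x r ∩ Ω)) with h | h
  · rw [← h, inv_zero, zero_mul]; positivity
  · rwa [inv_mul_le_iff₀ h]

/-- The volume of the truncated cone as an integral of its vertical sections. -/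
lemma volume_cone_eq (L δ : ℝ) : volume {x : E (n + 1) | L * ‖horiz x‖ < vert x ∧ vert x < δ} =
    ∫⁻ z : E n, ENNReal.ofReal (δ - L * ‖z‖) := by
  have hm1 : Measurable fun z : E n => L * ‖z‖ := by fun_prop
  have h := volume_regionBetween_eq_lintegral' (μ := (volume : Measure (E n))) hm1
    (measurable_const (a := δ)) MeasurableSet.univ
  rw [setLIntegral_univ] at h
  have h2 := (measurePreserving_horiz_vert (n := n)).measure_preimage
    (measurableSet_regionBetween hm1 (measurable_const (a := δ))
      MeasurableSet.univ).nullMeasurableSet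
  rw [Measure.volume_eq_prod, h] at h2
  rw [show {x : E (n + 1) | L * ‖horiz x‖ < vert x ∧ vert x < δ} =
    (fun x : E (n + 1) => (horiz x, vert x)) ⁻¹'
      regionBetween (fun z => L * ‖z‖) (fun _ => δ) univ by ext x; simp [regionBetween], h2]
  rfl

lemma enorm_ramp (δ : ℝ) (x : E (n + 1)) : ‖ramp δ x‖ₑ = ENNReal.ofReal (δ - vert x) := by
  rw [ramp, Real.enorm_of_nonneg (le_max_right _ _)]
  simp [ENNReal.ofReal_max]

/-! ### Lower bound for the constant. -/

namespace IsConicalDomain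
variable {k : ℕ∞} {L η δ : ℝ} {Ω : Set (E (n + 1))}

lemma le_lintegral_frontier (hn : 1 ≤ n) (h : IsConicalDomain k L η Ω) (hδ : δ < η) :
    ENNReal.ofReal (√(1 + L ^ 2)) *
        volume {x : E (n + 1) | L * ‖horiz x‖ < vert x ∧ vert x < δ} ≤
      ∫⁻ x in frontier Ω, ‖ramp δ x‖ₑ ∂(μHE[n]) := by
  have hemb := measurableEmbedding_coneGraph (n := n) L
  calc _ = ∫⁻ z : E n, ENNReal.ofReal (δ - L * ‖z‖)
          ∂(ENNReal.ofReal (√(1 + L ^ 2)) • (volume : Measure (E n))) := by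
        rw [volume_cone_eq, lintegral_smul_measure, smul_eq_mul]
    _ ≤ ∫⁻ z : E n, ENNReal.ofReal (δ - L * ‖z‖)
          ∂((μHE[n] : Measure (E (n + 1))).comap (coneGraph L)) :=
        lintegral_mono' (area_lower_bound hn L) le_rfl
    _ = ∫⁻ z : E n, ‖ramp δ (coneGraph L z)‖ₑ
          ∂((μHE[n] : Measure (E (n + 1))).comap (coneGraph L)) := by
        simp only [enorm_ramp, vert_coneGraph]
    _ = ∫⁻ x in range (coneGraph L), ‖ramp δ x‖ₑ ∂(μHE[n]) := by
        rw [← hemb.map_comap, hemb.lintegral_map]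
    -- The ramp vanishes from height `δ` on, and below that height the cone's surface lies in `∂Ω`.
    _ = ∫⁻ x in range (coneGraph L), {x : E (n + 1) | vert x < δ}.indicator
          (fun x => ‖ramp δ x‖ₑ) x ∂(μHE[n]) := by
        congr 1
        funext x
        by_cases hx : vert x < δ
        · rw [indicator_of_mem (by exact hx)]
        · rw [indicator_of_notMem (by exact hx), enorm_ramp, ENNReal.ofReal_eq_zero]
          linarith
    _ = ∫⁻ x in {x : E (n + 1) | vert x < δ} ∩ range (coneGraph L), ‖ramp δ x‖ₑ ∂(μHE[n]) := by
        rw [lintegral_indicator (measurableSet_vert_lt δ),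
          Measure.restrict_restrict (measurableSet_vert_lt δ)]
    _ ≤ _ := by
        refine lintegral_mono_set ?_
        rintro _ ⟨hx, z, rfl⟩
        refine h.coneGraph_mem_frontier (lt_trans ?_ hδ)
        simpa using hx

lemma sqrt_le_add (hn : 1 ≤ n) (hL : 0 < L) (h : IsConicalDomain k L η Ω) (hδ0 : 0 < δ)
    (hδ : δ < η) {C₁ C₂ : ℝ} (hC₁ : 0 < C₁) (hC₂ : 0 < C₂) (hS : SobolevTraceInequality Ω C₁ C₂) :
    √(1 + L ^ 2) ≤ C₁ + C₂ * δ := by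
  set S : Set (E (n + 1)) := {x | L * ‖horiz x‖ < vert x ∧ vert x < δ} with hSdef
  have hinter : {x : E (n + 1) | vert x < δ} ∩ Ω = S := by
    ext x
    constructor
    · rintro ⟨h1, h2⟩
      exact ⟨(h.mem_iff (lt_trans h1 hδ)).1 h2, h1⟩
    · rintro ⟨h1, h2⟩
      exact ⟨h2, (h.mem_iff (h2.trans hδ)).2 h1⟩
  have hSΩ : S ⊆ Ω := hinter ▸ inter_subset_right
  have hfin : volume S ≠ ⊤ := (h.isBounded.subset hSΩ).measure_lt_top.ne
  have hopen : IsOpen S :=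
    (isOpen_lt (continuous_const.mul continuous_horiz.norm) continuous_vert).inter
      (isOpen_lt continuous_vert continuous_const)
  have hpos : volume S ≠ 0 :=
    (hopen.measure_pos volume ⟨mkPoint 0 (δ / 2), by simp [hSdef]; linarith⟩).ne'
  have hG : ∫⁻ x in Ω, ‖rampGrad δ x‖ₑ = volume S := by
    simp only [enorm_rampGrad]
    rw [lintegral_indicator (measurableSet_vert_lt δ),
      Measure.restrict_restrict (measurableSet_vert_lt δ), hinter]
    simp
  have hu : ∫⁻ x in Ω, ‖ramp δ x‖ₑ ≤ ENNReal.ofReal δ * volume S := by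
    calc ∫⁻ x in Ω, ‖ramp δ x‖ₑ
        ≤ ∫⁻ x in Ω, {x : E (n + 1) | vert x < δ}.indicator (fun _ => ENNReal.ofReal δ) x := by
          refine setLIntegral_mono' h.isOpen.measurableSet fun x hx => ?_
          rw [enorm_ramp]
          by_cases hxδ : vert x < δ
          · rw [indicator_of_mem (by exact hxδ)]
            refine ENNReal.ofReal_le_ofReal ?_
            have h1 := (h.mem_iff (hxδ.trans hδ)).1 hx
            have h2 : 0 ≤ L * ‖horiz x‖ := by positivity
            linarith
          · rw [indicator_of_notMem (by exact hxδ), ENNReal.ofReal_eq_zero.2 (by linarith)]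
      _ = ENNReal.ofReal δ * volume S := by
          rw [lintegral_indicator (measurableSet_vert_lt δ),
            Measure.restrict_restrict (measurableSet_vert_lt δ), hinter]
          simp
  have hmain := (h.le_lintegral_frontier hn hδ).trans
    (hS _ _ _ (isSobolevWithGradient_ramp h.isBounded δ)
      (isTrace_self (lipschitzWith_ramp δ)))
  rw [hG] at hmain
  have h2 : ENNReal.ofReal (√(1 + L ^ 2)) * volume S ≤
      ENNReal.ofReal (C₁ + C₂ * δ) * volume S := by
    refine hmain.trans ?_
    rw [ENNReal.ofReal_add hC₁.le (by positivity), ENNReal.ofReal_mul hC₂.le, add_mul, mul_assoc]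
    gcongr
  rw [ENNReal.mul_le_mul_iff_left hpos hfin] at h2
  exact (ENNReal.ofReal_le_ofReal_iff (by positivity)).1 h2

lemma sqrt_le (hn : 1 ≤ n) (hL : 0 < L) (h : IsConicalDomain k L η Ω) (hη : 0 < η)
    {C₁ C₂ : ℝ} (hC₁ : 0 < C₁) (hC₂ : 0 < C₂) (hS : SobolevTraceInequality Ω C₁ C₂) :
    √(1 + L ^ 2) ≤ C₁ := by
  have hlim : Tendsto (fun δ : ℝ => C₁ + C₂ * δ) (𝓝[>] 0) (𝓝 C₁) := by
    have : Continuous fun δ : ℝ => C₁ + C₂ * δ := by fun_prop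
    simpa using (this.tendsto 0).mono_left (nhdsWithin_le_nhds (s := Ioi 0))
  refine ge_of_tendsto hlim ?_
  filter_upwards [Ioo_mem_nhdsGT hη] with δ hδ
  exact h.sqrt_le_add hn hL hδ.1 hδ.2 hC₁ hC₂ hS

end IsConicalDomain

/-! ### Existence of smooth conical domains. -/

/-- A smooth function which vanishes for `t ≤ η`, equals `1` at `t = 3η` only, and is less than
`1` exactly for `t < 3η`. -/
noncomputable def cutoff (η t : ℝ) : ℝ :=
  Real.smoothTransition ((t - η) / η) * ((t - η) / (2 * η))

/-- The square of `L` times the radius of a smooth conical domain at height `t`. -/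
noncomputable def profile (η t : ℝ) : ℝ := t ^ 2 * (1 - cutoff η t)

lemma contDiff_profile (η : ℝ) {k : ℕ∞} : ContDiff ℝ (k : WithTop ℕ∞) (profile η) := by
  have h1 : ContDiff ℝ (k : WithTop ℕ∞) fun t : ℝ => (t - η) / η :=
    (contDiff_id.sub contDiff_const).div_const _
  have h2 : ContDiff ℝ (k : WithTop ℕ∞) fun t : ℝ => (t - η) / (2 * η) :=
    (contDiff_id.sub contDiff_const).div_const _
  exact (contDiff_id.pow 2).mul (contDiff_const.sub ((Real.smoothTransition.contDiff.comp h1).mul h2))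

lemma profile_of_le {η t : ℝ} (hη : 0 < η) (ht : t ≤ η) : profile η t = t ^ 2 := by
  rw [profile, cutoff, Real.smoothTransition.zero_of_nonpos
    (div_nonpos_of_nonpos_of_nonneg (by linarith) hη.le)]
  ring

lemma profile_of_ge {η t : ℝ} (hη : 0 < η) (ht : 2 * η ≤ t) :
    profile η t = t ^ 2 * (1 - (t - η) / (2 * η)) := by
  rw [profile, cutoff, Real.smoothTransition.one_of_one_le
    ((one_le_div hη).2 (by linarith)), one_mul]

lemma profile_pos {η t : ℝ} (hη : 0 < η) (ht : 0 < t) (ht' : t < 3 * η) : 0 < profile η t := by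
  refine mul_pos (by positivity) (sub_pos.2 ?_)
  rcases le_total t η with h | h
  · rw [cutoff, Real.smoothTransition.zero_of_nonpos
      (div_nonpos_of_nonpos_of_nonneg (by linarith) hη.le)]
    simp
  · calc cutoff η t ≤ 1 * ((t - η) / (2 * η)) :=
        mul_le_mul_of_nonneg_right (Real.smoothTransition.le_one _)
          (div_nonneg (by linarith) (by linarith))
      _ < 1 := by rw [one_mul, div_lt_one (by linarith)]; linarith

lemma profile_nonpos {η t : ℝ} (hη : 0 < η) (ht : 3 * η ≤ t) : profile η t ≤ 0 := by
  rw [profile_of_ge hη (by linarith)]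
  refine mul_nonpos_of_nonneg_of_nonpos (sq_nonneg _) (sub_nonpos.2 ?_)
  rw [one_le_div (by linarith)]
  linarith

lemma profile_eq_zero {η t : ℝ} (hη : 0 < η) (ht : 0 < t) (h : profile η t = 0) : t = 3 * η := by
  rcases lt_or_ge t (3 * η) with h' | h'
  · exact absurd h (profile_pos hη ht h').ne'
  · rw [profile_of_ge hη (by linarith)] at h
    have h1 : 1 - (t - η) / (2 * η) = 0 := by
      rcases mul_eq_zero.1 h with h0 | h0
      · exact absurd h0 (by positivity)
      · exact h0
    field_simp at h1
    linarith

/-- The nonzero slope at the top height `3η` makes the surface regular where it crosses the axis. -/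
lemma hasDerivAt_profile {η : ℝ} (hη : 0 < η) :
    HasDerivAt (profile η) (-(9 * η / 2)) (3 * η) := by
  have h : HasDerivAt (fun t : ℝ => t ^ 2 * (1 - (t - η) / (2 * η))) (-(9 * η / 2)) (3 * η) := by
    have h1 := (hasDerivAt_pow 2 (3 * η)).mul
      ((((hasDerivAt_id (3 * η)).sub_const η).div_const (2 * η)).const_sub 1)
    refine h1.congr_deriv ?_
    simp only [id]
    field_simp
    ring
  refine h.congr_of_eventuallyEq ?_
  filter_upwards [lt_mem_nhds (show 2 * η < 3 * η by linarith)] with t ht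
  exact profile_of_ge hη ht.le

/-- The defining function of a smooth conical domain. -/
noncomputable def conicalFun (L η : ℝ) (x : E (n + 1)) : ℝ :=
  L ^ 2 * ‖horiz x‖ ^ 2 - profile η (vert x)

/-- A conical domain which is smooth away from the origin. -/
def smoothConicalDomain (n : ℕ) (L η : ℝ) : Set (E (n + 1)) :=
  {x | 0 < vert x ∧ conicalFun L η x < 0}

lemma contDiff_conicalFun (L η : ℝ) {k : ℕ∞} :
    ContDiff ℝ (k : WithTop ℕ∞) (conicalFun L η : E (n + 1) → ℝ) :=
  (contDiff_const.mul (contDiff_horiz.norm_sq ℝ)).sub ((contDiff_profile η).comp contDiff_vert)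

lemma fderiv_conicalFun_ne_zero {L η : ℝ} (hL : 0 < L) (hη : 0 < η) {p : E (n + 1)}
    (hp : 0 < vert p) (h0 : conicalFun L η p = 0) : fderiv ℝ (conicalFun L η) p ≠ 0 := by
  intro hd
  have hdiff : DifferentiableAt ℝ (conicalFun L η : E (n + 1) → ℝ) p :=
    (contDiff_conicalFun L η (k := 1)).differentiable (by simp) p
  have hl := hdiff.hasFDerivAt.hasLineDerivAt
  rw [hd] at hl
  -- On the axis `p` is the top point and the vertical derivative is nonzero; off the axis, the
  -- derivative along `(p', 0)` is positive.
  by_cases hh : horiz p = 0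
  · have hv : vert p = 3 * η := by
      refine profile_eq_zero hη hp ?_
      simpa [conicalFun, hh] using h0
    have h1 : HasLineDerivAt ℝ (conicalFun L η : E (n + 1) → ℝ) (9 * η / 2) p (mkPoint 0 1) := by
      have h2 : HasDerivAt (fun t : ℝ => -profile η (3 * η + t)) (9 * η / 2) 0 := by
        have h3 : HasDerivAt (profile η) (-(9 * η / 2)) (3 * η + 0) := by
          simpa using hasDerivAt_profile hη
        refine (h3.comp_const_add (3 * η) 0).neg.congr_deriv ?_
        ring
      simpa [HasLineDerivAt, conicalFun, hh, hv] using h2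
    have := (hl _).unique h1
    simp at this
    linarith
  · have h1 : HasLineDerivAt ℝ (conicalFun L η : E (n + 1) → ℝ) (L ^ 2 * ‖horiz p‖ ^ 2 * 2) p
        (mkPoint (horiz p) 0) := by
      have h2 : HasDerivAt (fun t : ℝ => L ^ 2 * ‖horiz p‖ ^ 2 * (1 + t) ^ 2 - profile η (vert p))
          (L ^ 2 * ‖horiz p‖ ^ 2 * 2) 0 := by
        have h3 := ((((hasDerivAt_id (0 : ℝ)).const_add 1).pow 2).const_mul
          (L ^ 2 * ‖horiz p‖ ^ 2)).sub_const (profile η (vert p))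
        simpa using h3
      have h4 : (fun t : ℝ => conicalFun L η (p + t • mkPoint (horiz p) 0)) =
          fun t : ℝ => L ^ 2 * ‖horiz p‖ ^ 2 * (1 + t) ^ 2 - profile η (vert p) := by
        funext t
        have h5 : horiz p + t • horiz p = (1 + t) • horiz p := by module
        simp only [conicalFun, horiz_add, horiz_smul, horiz_mkPoint, vert_add, vert_smul,
          vert_mkPoint, h5, norm_smul, mul_pow, Real.norm_eq_abs, sq_abs, mul_zero, add_zero]
        ring
      rw [HasLineDerivAt, h4]
      exact h2
    have h6 := (hl _).unique h1
    have h7 : 0 < L ^ 2 * ‖horiz p‖ ^ 2 * 2 := by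
      have := norm_pos_iff.2 hh
      positivity
    rw [← h6] at h7
    simp at h7

lemma isConicalDomain_smoothConicalDomain {L η : ℝ} (hL : 0 < L) (hη : 0 < η) :
    IsConicalDomain (⊤ : ℕ∞) L η (smoothConicalDomain n L η) := by
  have hcont : Continuous (conicalFun L η : E (n + 1) → ℝ) :=
    (contDiff_conicalFun L η (k := 0)).continuous
  have hopen : IsOpen (smoothConicalDomain n L η) :=
    (isOpen_lt continuous_const continuous_vert).inter (isOpen_lt hcont continuous_const)
  have hlt : ∀ x ∈ smoothConicalDomain n L η, vert x < 3 * η := by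
    rintro x ⟨hx1, hx2⟩
    by_contra! h
    have := profile_nonpos hη h
    have h2 : 0 ≤ L ^ 2 * ‖horiz x‖ ^ 2 := by positivity
    rw [conicalFun] at hx2
    linarith
  refine ⟨hopen, ?_, ?_, ?_, ?_⟩
  -- Rescaling each horizontal slice to the unit ball presents the domain as a continuous image of a
  -- connected product.
  · have himg : smoothConicalDomain n L η =
        (fun q : E n × ℝ => mkPoint ((√(profile η q.2) / L) • q.1) q.2) ''
          (Metric.ball 0 1 ×ˢ Ioo 0 (3 * η)) := by
      ext x
      constructor
      · intro hx
        have hpos := profile_pos hη hx.1 (hlt x hx)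
        have hs := Real.sqrt_pos.2 hpos
        refine ⟨((L / √(profile η (vert x))) • horiz x, vert x), ⟨?_, hx.1, hlt x hx⟩, ?_⟩
        · rw [mem_ball_zero_iff, norm_smul, Real.norm_of_nonneg (by positivity), div_mul_eq_mul_div,
            div_lt_one hs]
          refine Real.lt_sqrt_of_sq_lt ?_
          have := hx.2
          rw [conicalFun] at this
          rw [mul_pow]; linarith
        · refine ext_horiz_vert ?_ (by simp)
          rw [horiz_mkPoint, smul_smul]
          simp only
          rw [div_mul_div_cancel₀ hL.ne', div_self hs.ne', one_smul]
      · rintro ⟨⟨z, t⟩, ⟨hz, ht0, ht⟩, rfl⟩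
        have hpos := profile_pos hη ht0 ht
        have hz1 : ‖z‖ < 1 := by simpa using hz
        refine ⟨by simpa using ht0, ?_⟩
        simp only [conicalFun, horiz_mkPoint, vert_mkPoint, norm_smul, mul_pow, norm_div,
          Real.norm_eq_abs, div_pow, sq_abs, Real.sq_sqrt hpos.le]
        rw [← mul_assoc, mul_div_cancel₀ _ (by positivity)]
        have : ‖z‖ ^ 2 < 1 := by nlinarith [norm_nonneg z]
        nlinarith
    rw [himg]
    refine (IsConnected.prod ?_ (isConnected_Ioo (by linarith))).image _
      (Continuous.continuousOn ?_)
    · exact (convex_ball 0 1).isConnected ⟨0, by simp⟩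
    · have hp : Continuous (profile η) := (contDiff_profile η (k := 0)).continuous
      exact continuous_mkPoint.comp
        (f := fun q : E n × ℝ => ((√(profile η q.2) / L) • q.1, q.2)) (by fun_prop)
  · obtain ⟨M, hM⟩ := (isCompact_Icc (a := 0) (b := 3 * η)).exists_bound_of_continuousOn
      (contDiff_profile η (k := 0)).continuous.continuousOn
    refine (isBounded_iff_forall_norm_le).2 ⟨√(M / L ^ 2 + (3 * η) ^ 2), fun x hx => ?_⟩
    refine Real.le_sqrt_of_sq_le ?_
    rw [norm_sq_eq_horiz_vert]
    refine add_le_add ?_ (pow_le_pow_left₀ hx.1.le (hlt x hx).le 2)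
    rw [le_div_iff₀ (by positivity)]
    have h1 := (le_abs_self _).trans (hM (vert x) ⟨hx.1.le, (hlt x hx).le⟩)
    have h2 := hx.2
    rw [conicalFun] at h2
    linarith
  · ext x
    simp only [smoothConicalDomain, mem_inter_iff, mem_ofPred_eq]
    have key : vert x < η → 0 < vert x →
        (conicalFun L η x < 0 ↔ L * ‖horiz x‖ < vert x) := fun h h0 => by
      rw [conicalFun, profile_of_le hη h.le, ← mul_pow, sub_neg]
      exact sq_lt_sq₀ (by positivity) h0.le
    constructor
    · rintro ⟨⟨h0, h1⟩, h2⟩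
      exact ⟨(key h2 h0).1 h1, h2⟩
    · rintro ⟨h1, h2⟩
      have h0 : 0 < vert x := lt_of_le_of_lt (by positivity) h1
      exact ⟨⟨h0, (key h2 h0).2 h1⟩, h2⟩
  · intro p hp hpη
    have hp0 : 0 < vert p := by linarith
    -- The half-space excludes the lower nappe, where `conicalFun` is negative too.
    refine ⟨{x | 0 < vert x}, conicalFun L η, isOpen_lt continuous_const continuous_vert, hp0,
      (contDiff_conicalFun L η).contDiffOn, fderiv_conicalFun_ne_zero hL hη hp0 ?_, fun x hx =>
      ⟨fun h => h.2, fun h => ⟨hx, h⟩⟩⟩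
    rw [hopen.frontier_eq] at hp
    refine le_antisymm ?_ (not_lt.1 fun h => hp.2 ⟨hp0, h⟩)
    exact closure_minimal (t := {x | conicalFun L η x ≤ 0}) (fun x hx => hx.2.le)
      (isClosed_le hcont continuous_const) hp.1

end ConeTrace

theorem mainTheorem7 (n : ℕ) (hn : 1 ≤ n) (L : ℝ) (hL : 0 < L) :
    (∀ (k : ℕ∞) (η : ℝ) (Ω : Set (ConeTrace.E (n + 1))), 1 ≤ k → 0 < η →
      ConeTrace.IsConicalDomain k L η Ω →
        ConeTrace.IsBoundedLipschitzDomain Ω ∧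
        (0 ∈ frontier Ω ∧ ∀ p ∈ frontier Ω, p ≠ 0 → ConeTrace.HasCkBoundaryAt k Ω p) ∧
        (∀ C₁ C₂ : ℝ, 0 < C₁ → 0 < C₂ → ConeTrace.SobolevTraceInequality Ω C₁ C₂ →
          √(1 + L ^ 2) ≤ C₁) ∧
        (∀ C₁ C₂ : ℝ, 0 < C₁ → 0 < C₂ → ConeTrace.BVTraceInequality Ω C₁ C₂ →
          √(1 + L ^ 2) ≤ C₁) ∧
        ¬ (∀ ε : ℝ, 0 < ε → ∃ C₂ : ℝ, 0 < C₂ ∧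
          ConeTrace.SobolevTraceInequality Ω (1 + ε) C₂)) ∧
    (∀ η : ℝ, 0 < η → ∃ Ω : Set (ConeTrace.E (n + 1)),
      ConeTrace.IsConicalDomain (⊤ : ℕ∞) L η Ω) := by
  refine ⟨fun k η Ω hk hη h => ⟨h.isBoundedLipschitzDomain hk hL hη,
    ⟨h.zero_mem_frontier hη, fun p hp hp0 => h.hasCkBoundaryAt hη hp hp0⟩,
    fun C₁ C₂ hC₁ hC₂ hS => h.sqrt_le hn hL hη hC₁ hC₂ hS,
    fun C₁ C₂ hC₁ hC₂ hS => h.sqrt_le hn hL hη hC₁ hC₂ hS.sobolevTraceInequality,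
    fun hall => ?_⟩, fun η hη => ⟨_, ConeTrace.isConicalDomain_smoothConicalDomain hL hη⟩⟩
  have hlt : 1 < √(1 + L ^ 2) := Real.lt_sqrt_of_sq_lt (by nlinarith)
  -- This puts `1 + ε` midway between `1` and `√(1 + L²)`.
  obtain ⟨C₂, hC₂, hS⟩ := hall ((√(1 + L ^ 2) - 1) / 2) (by linarith)
  have := h.sqrt_le hn hL hη (by linarith) hC₂ hS
  linarith
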